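/- **Setting.** Let $\mathcal C$ be an elementary topos (a finitely complete cartesian closed category with a subobject classifier $\Omega$), and write $PX=\Omega^X$ for power objects, $\mathrm{Sub}(X)$ for the Heyting algebra of subobjects of $X$, with order $\preceq_X$. In the internal language of $\mathcal C$, for a variable $F:PPX$, let $\mathcal F(F)$ be the conjunction of (i) $\forall A.\forall B.\ A\in F\wedge B\in F\Rightarrow A\wedge B\in F$; (ii) $\forall A.\forall B.\ A\in F\wedge A\preceq_X B\Rightarrow B\in F$; (iii) $X\in F$; (iv) $\forall A.\ A\in F\Rightarrow\exists x.\,x\in A$. A *structuring neighborhood* is a morphism $N:X\to PPX$ such that $\forall x.\ \mathcal F(N(x))$ and $\forall x.\forall A.\ A\in N(x)\Rightarrow x\in A$ hold internally. It is a *topological neighborhood* if moreover $$\forall x.\forall A.\ A\in N(x)\Rightarrow\exists B.\ \bigl(B\in N(x)\wedge\forall y.\,(y\in B\Rightarrow A\in N(y))\bigr)$$ holds internally. The *erosion* and the *dilation* by $N$ are the morphisms $\varepsilon[N],\delta[N]:PX\to PX$ given by $$\varepsilon[N](Y)=\{x\mid Y\in N(x)\},\qquad \delta[N](Y)=\{x\mid\exists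 F.\ \mathcal F(F)\wedge Y\in F\wedge N(x)\preceq_{PX}F\};$$ through $\mathrm{Hom}(\mathbb 1,PX)\simeq\mathrm{Sub}(X)$ they induce maps $\overline{\varepsilon[N]},\overline{\delta[N]}:\mathrm{Sub}(X)\to\mathrm{Sub}(X)$. **Formulas and models.** Formulas over a set $PV$ of propositional variables are generated by $\top,\bot,p\in PV,\neg,\wedge,\vee,\Rightarrow,\Box,\Diamond$. A *model* $\mathcal M=(X,N,\nu)$ over $\mathcal C$ consists of an object $X$, a structuring neighborhood $N:X\to PPX$ and a map $\nu:PV\to\mathrm{Sub}(X)$. Formulas are interpreted in $\mathrm{Sub}(X)$: $[\![p]\!]=\nu(p)$; $\top,\bot,\wedge,\vee,\Rightarrow$ by the Heyting operations; $[\![\neg\varphi]\!]=[\![\varphi]\!]\to\bot$; $[\![\Box\varphi]\!]=\overline{\varepsilon[N]}([\![\varphi]\!])$; $[\![\Diamond\varphi]\!]=\overline{\delta[N]}([\![\varphi]\!])$. A sequent $\varphi\vdash\psi$ is *valid* in $\mathcal M$ if $[\![\varphi]\!]\preceq_X[\![\psi]\!]$. **Calculus.** The *basic calculus* has the axioms (where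 $\dashv\vdash$ means both directions): $\varphi\vdash\varphi$; $\bot\vdash\psi$; $\varphi\vdash\top$; $\Box\top\dashv\vdash\top$; $\Diamond\bot\dashv\vdash\bot$; $\Box\neg\varphi\vdash\neg\Diamond\varphi$; $\Box(\varphi\wedge\psi)\dashv\vdash\Box\varphi\wedge\Box\psi$; $\Diamond\varphi\vee\Diamond\psi\vdash\Diamond(\varphi\vee\psi)$; $\Box(\varphi\Rightarrow\psi)\vdash\Box\varphi\Rightarrow\Box\psi$; $\Box\varphi\vdash\varphi$; $\varphi\vdash\Diamond\varphi$; $\varphi\wedge\psi\vdash\varphi$; $\varphi\wedge\psi\vdash\psi$; $\varphi\wedge\varphi\dashv\vdash\varphi$; $\varphi\wedge\psi\dashv\vdash\psi\wedge\varphi$; $\varphi\vdash\varphi\vee\psi$; $\psi\vdash\varphi\vee\psi$; $\varphi\vee\psi\dashv\vdash\psi\vee\varphi$; $\varphi\wedge(\psi\vee\chi)\dashv\vdash(\varphi\wedge\psi)\vee(\varphi\wedge\chi)$; $\neg\varphi\dashv\vdash\varphi\Rightarrow\bot$; and the rules: cut (from $\varphi\vdash\psi$ and $\psi\vdash\chi$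 infer $\varphi\vdash\chi$); from $\varphi\vdash\psi$ and $\varphi\vdash\chi$ infer $\varphi\vdash\psi\wedge\chi$; from $\varphi\vdash\chi$ and $\psi\vdash\chi$ infer $\varphi\vee\psi\vdash\chi$, and conversely; from $\varphi\wedge\psi\vdash\chi$ infer $\varphi\vdash\psi\Rightarrow\chi$, and conversely; from $\varphi\vdash\psi$ infer $\Box\varphi\vdash\Box\psi$ and $\Diamond\varphi\vdash\Diamond\psi$. To it one may add the *S4 axioms* $\Box\varphi\vdash\Box\Box\varphi$ and $\Diamond\Diamond\varphi\vdash\Diamond\varphi$, or the *classical axiom* $\neg\neg\varphi\vdash\varphi$, or both. **Theorem (Soundness).** Every sequent derivable in the basic calculus is valid in every model over every elementary topos. Every sequent derivable with the S4 axioms added is valid in every model $(X,N,\nu)$ in which $N$ is a topological neighborhood. If $\mathcal C$ is Boolean (that is, every $\mathrm{Sub}(X)$ is a Boolean algebra), the same two statements hold, for models over $\mathcal C$, with the classical axiom also added to the calculus. -/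

import Mathlib

open CategoryTheory CategoryTheory.Limits CategoryTheory.MonoidalCategory
open CategoryTheory.CartesianMonoidalCategory

universe u v w

/-- An elementary topos: a finitely complete cartesian closed category with a subobject
classifier. -/
class ElemTopos (C : Type u) [Category.{v} C] extends
    CartesianMonoidalCategory C, MonoidalClosed C, HasFiniteLimits C where
  /-- the subobject classifier `true : 𝟙 ⟶ Ω` -/
  classifier : Subobject.Classifier C

namespace ElemTopos

noncomputable section

set_option linter.unusedSectionVars false

variable {C : Type u} [Category.{v} C] [ElemTopos C]

/-! ### Characteristic morphisms, power objects, membership, comprehension -/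

/-- The object of truth values. -/
abbrev Ω (C : Type u) [Category.{v} C] [ElemTopos C] : C := (classifier (C := C)).Ω

/-- The subobject of `X` classified by `f : X ⟶ Ω`, i.e. the pullback of `true` along `f`. -/
def sub {X : C} (f : X ⟶ Ω C) : Subobject X :=
  (Subobject.pullback f).obj (Subobject.mk (classifier (C := C)).truth)

/-- The characteristic morphism of a subobject. -/
def chi {X : C} (S : Subobject X) : X ⟶ Ω C := (classifier (C := C)).χ S.arrow

@[simp] theorem sub_chi {X : C} (S : Subobject X) : sub (chi S) = S :=
  (classifier (C := C)).representableBy.homEquiv.right_inv S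

@[simp] theorem chi_sub {X : C} (f : X ⟶ Ω C) : chi (sub f) = f :=
  (classifier (C := C)).representableBy.homEquiv.left_inv f

theorem sub_comp {X Y : C} (g : Y ⟶ X) (f : X ⟶ Ω C) :
    sub (g ≫ f) = (Subobject.pullback g).obj (sub f) := by
  simp [sub, Subobject.pullback_comp]

theorem chi_pullback {X Y : C} (g : Y ⟶ X) (S : Subobject X) :
    chi ((Subobject.pullback g).obj S) = g ≫ chi S := by
  rw [← chi_sub (g ≫ chi S), sub_comp, sub_chi]

/-- The power object `PX = Ω ^ X`. -/
abbrev Pow (X : C) : C := (ihom X).obj (Ω C)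

/-- The membership relation `∈_X ↣ X × PX`: the subobject whose characteristic morphism is the
transpose of the identity of `PX`. -/
def memRel (X : C) : Subobject (X ⊗ Pow X) := sub (MonoidalClosed.uncurry (𝟙 (Pow X)))

/-- The term `{x : X ∣ φ}` in context `Γ`, for a formula `φ` in context `(x, Γ)`: the transpose of
the characteristic morphism of `φ`. -/
def compr {X Γ : C} (φ : Subobject (X ⊗ Γ)) : Γ ⟶ Pow X := MonoidalClosed.curry (chi φ)

theorem pullback_memRel {X Γ : C} (r : Γ ⟶ Pow X) :
    (Subobject.pullback (X ◁ r)).obj (memRel X) = sub (MonoidalClosed.uncurry r) := by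
  rw [memRel, ← sub_comp, ← MonoidalClosed.uncurry_natural_left, Category.comp_id]

/-- `compr φ` is the unique `r` such that `φ` is the pullback of `∈_X` along `Id × r`. -/
theorem pullback_memRel_eq_iff {X Γ : C} (φ : Subobject (X ⊗ Γ)) (r : Γ ⟶ Pow X) :
    (Subobject.pullback (X ◁ r)).obj (memRel X) = φ ↔ r = compr φ := by
  rw [pullback_memRel]
  constructor
  · rintro rfl
    simp [compr]
  · rintro rfl
    simp [compr]

/-! ### Generalized elements of subobjects -/

theorem factors_iff_pullback {X Y : C} (S : Subobject X) (z : Y ⟶ X) :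
    S.Factors z ↔ (Subobject.pullback z).obj S = ⊤ := by
  constructor
  · intro h
    refine top_le_iff.1 (Subobject.le_of_factors ?_)
    have hp := Subobject.isPullback z S
    have h' : S.Factors ((⊤ : Subobject Y).arrow ≫ z) := Subobject.factors_of_factors_right _ h
    refine (Subobject.factors_iff _ _).2 ?_
    exact ⟨hp.lift (S.factorThru _ h') (⊤ : Subobject Y).arrow (by simp), hp.lift_snd _ _ _⟩
  · intro h
    have hp := Subobject.isPullback z S
    have hf : ((Subobject.pullback z).obj S).Factors (𝟙 Y) := by
      rw [h]; exact Subobject.top_factors _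
    have : z = (((Subobject.pullback z).obj S).factorThru _ hf ≫ Subobject.pullbackπ z S) ≫
        S.arrow := by
      rw [Category.assoc, hp.w, ← Category.assoc, Subobject.factorThru_arrow, Category.id_comp]
    rw [this]
    exact Subobject.factors_comp_arrow _

theorem pullback_factors {X Y Z : C} (S : Subobject X) (z : Y ⟶ X) (y : Z ⟶ Y) :
    ((Subobject.pullback z).obj S).Factors y ↔ S.Factors (y ≫ z) := by
  rw [factors_iff_pullback, factors_iff_pullback, Subobject.pullback_comp]

theorem le_iff_factors {X : C} {S T : Subobject X} :
    S ≤ T ↔ ∀ {Y : C} (z : Y ⟶ X), S.Factors z → T.Factors z :=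
  ⟨fun h _ z hz => Subobject.factors_of_le z h hz,
    fun h => Subobject.le_of_factors (h _ S.factors_self)⟩

theorem factors_precomp {X Y Z : C} {S : Subobject X} {z : Y ⟶ X} (hz : S.Factors z)
    (y : Z ⟶ Y) : S.Factors (y ≫ z) := Subobject.factors_of_factors_right _ hz

/-- The equalizer of two terms, i.e. the formula `s = t`. -/
def eqF {Γ X : C} (s t : Γ ⟶ X) : Subobject Γ := equalizerSubobject s t

theorem eqF_factors {Γ X Δ : C} (s t : Γ ⟶ X) (z : Δ ⟶ Γ) :
    (eqF s t).Factors z ↔ z ≫ s = z ≫ t :=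
  equalizerSubobject_factors_iff s t z

/-- Heyting implication of subobjects: the equalizer of the characteristic morphisms of `S ⊓ T`
and `S`. -/
def impS {X : C} (S T : Subobject X) : Subobject X := eqF (chi (S ⊓ T)) (chi S)

theorem le_impS_iff {X : C} (R S T : Subobject X) : R ≤ impS S T ↔ R ⊓ S ≤ T := by
  have key : ∀ {Y : C} (z : Y ⟶ X), (impS S T).Factors z ↔
      (Subobject.pullback z).obj (S ⊓ T) = (Subobject.pullback z).obj S := by
    intro Y z
    rw [impS, eqF_factors, ← chi_pullback, ← chi_pullback]
    exact ⟨fun h => by simpa using congrArg sub h, fun h => by rw [h]⟩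
  constructor
  · intro h
    rw [le_iff_factors]
    intro Y z hz
    rw [Subobject.inf_factors] at hz
    have h1 := (key z).1 (Subobject.factors_of_le z h hz.1)
    rw [(factors_iff_pullback _ _).1 hz.2, ← factors_iff_pullback, Subobject.inf_factors] at h1
    exact h1.2
  · intro h
    rw [le_iff_factors]
    intro Y z hz
    rw [key]
    refine le_antisymm ?_ ?_
    · rw [le_iff_factors]
      intro W y hy
      rw [pullback_factors, Subobject.inf_factors] at hy
      exact (pullback_factors _ _ _).2 hy.1
    · rw [le_iff_factors]
      intro W y hy
      rw [pullback_factors] at hy ⊢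
      rw [Subobject.inf_factors]
      refine ⟨hy, Subobject.factors_of_le _ h ?_⟩
      rw [Subobject.inf_factors]
      exact ⟨factors_precomp hz y, hy⟩

theorem impS_factors {X Y : C} (S T : Subobject X) (z : Y ⟶ X) :
    (impS S T).Factors z ↔ ∀ {W : C} (y : W ⟶ Y), S.Factors (y ≫ z) → T.Factors (y ≫ z) := by
  constructor
  · intro h W y hy
    refine Subobject.factors_of_le _ ((le_impS_iff (impS S T) S T).1 le_rfl) ?_
    rw [Subobject.inf_factors]
    exact ⟨factors_precomp h y, hy⟩
  · intro h
    rw [impS, eqF_factors, ← chi_pullback, ← chi_pullback]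
    congr 1
    refine le_antisymm ?_ ?_ <;> rw [le_iff_factors] <;> intro W y hy <;>
      rw [pullback_factors] at hy ⊢
    · exact ((Subobject.inf_factors _).1 hy).1
    · exact (Subobject.inf_factors _).2 ⟨hy, h y hy⟩

/-! ### Quantifiers -/

/-- The formula `∀ x : A. φ` in context `Γ`, for `φ` in context `(x, Γ)`. By `le_all_iff` this is
the right adjoint to the pullback along the projection `A × Γ ⟶ Γ`. -/
def all {Γ : C} (A : C) (φ : Subobject (A ⊗ Γ)) : Subobject Γ := eqF (compr φ) (compr ⊤)

theorem all_factors_iff_pullback {Γ A Δ : C} (φ : Subobject (A ⊗ Γ)) (z : Δ ⟶ Γ) :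
    (all A φ).Factors z ↔ (Subobject.pullback (A ◁ z)).obj φ = ⊤ := by
  rw [all, eqF_factors, compr, compr, ← MonoidalClosed.curry_natural_left,
    ← MonoidalClosed.curry_natural_left, ← chi_pullback, ← chi_pullback, Subobject.pullback_top]
  constructor
  · intro h
    simpa using congrArg (fun f => sub (MonoidalClosed.uncurry f)) h
  · intro h
    rw [h]

theorem all_factors {Γ A Δ : C} (φ : Subobject (A ⊗ Γ)) (z : Δ ⟶ Γ) :
    (all A φ).Factors z ↔
      ∀ {W : C} (a : W ⟶ A) (y : W ⟶ Δ), φ.Factors (lift a (y ≫ z)) := by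
  rw [all_factors_iff_pullback, ← factors_iff_pullback]
  constructor
  · intro h W a y
    have := factors_precomp h (lift a y)
    rwa [lift_whiskerLeft] at this
  · intro h
    have := h (fst A Δ) (snd A Δ)
    convert! this using 1
    ext <;> simp

/-- Universal quantification is right adjoint to weakening. -/
theorem le_all_iff {Γ A : C} (φ : Subobject (A ⊗ Γ)) (S : Subobject Γ) :
    S ≤ all A φ ↔ (Subobject.pullback (snd A Γ)).obj S ≤ φ := by
  constructor
  · intro h
    rw [le_iff_factors]
    intro Y z hz
    rw [pullback_factors] at hz
    have := (all_factors _ _).1 (Subobject.factors_of_le _ h hz) (z ≫ fst _ _) (𝟙 Y)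
    convert! this using 1
    ext <;> simp
  · intro h
    rw [le_iff_factors]
    intro Y z hz
    rw [all_factors]
    intro W a y
    refine Subobject.factors_of_le _ h ?_
    rw [pullback_factors]
    simpa using factors_precomp hz y

/-- The image of any morphism exists. -/
theorem exists_image {A B : C} (f : A ⟶ B) :
    ∃ I : Subobject B, IsLeast {T : Subobject B | T.Factors f} I := by
  let E : Subobject (A ⊗ (Ω C ⊗ B)) := eqF (fst _ _ ≫ f) (snd _ _ ≫ snd _ _)
  let W : Subobject (Ω C ⊗ B) := sub (fst _ _)
  let I : Subobject B :=
    all (Ω C) (impS (all A (impS E ((Subobject.pullback (snd _ _)).obj W))) W)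
  refine ⟨I, ?_, ?_⟩
  · change I.Factors f
    rw [all_factors]
    intro V ω y
    rw [impS_factors]
    intro V' y' h
    rw [all_factors] at h
    have h1 := h (y' ≫ y) (𝟙 V')
    rw [impS_factors] at h1
    have h2 := h1 (𝟙 V') (by
      rw [eqF_factors]
      simp)
    rw [pullback_factors] at h2
    simpa using h2
  · intro T hT
    change T.Factors f at hT
    rw [le_iff_factors]
    intro Z z hz
    rw [all_factors] at hz
    have h1 := hz (chi ((Subobject.pullback z).obj T)) (𝟙 Z)
    rw [impS_factors] at h1
    have hW : ∀ {V : C} (y : V ⟶ Z),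
        W.Factors (y ≫ lift (chi ((Subobject.pullback z).obj T)) (𝟙 Z ≫ z)) ↔
          T.Factors (y ≫ z) := by
      intro V y
      rw [← pullback_factors T z y]
      rw [factors_iff_pullback, factors_iff_pullback, ← sub_comp, Category.assoc, lift_fst,
        sub_comp, sub_chi]
    have h2 := h1 (𝟙 Z) (by
      rw [all_factors]
      intro V a y
      rw [impS_factors]
      intro V' y' hE
      rw [eqF_factors] at hE
      rw [pullback_factors]
      have e : (y' ≫ lift a (y ≫ 𝟙 Z ≫ lift (chi ((Subobject.pullback z).obj T)) (𝟙 Z ≫ z))) ≫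
          snd _ _ = (y' ≫ y) ≫ lift (chi ((Subobject.pullback z).obj T)) (𝟙 Z ≫ z) := by
        simp
      rw [e, hW]
      have e2 : (y' ≫ y) ≫ z = (y' ≫ a) ≫ f := by
        simpa using hE.symm
      rw [e2]
      exact factors_precomp hT _)
    simpa using (hW (𝟙 Z)).1 h2

instance hasImages : HasImages C where
  has_image {A B} f := by
    obtain ⟨I, hI⟩ := exists_image f
    have hle : ∀ F' : MonoFactorisation f, I ≤ Subobject.mk F'.m := fun F' =>
      hI.2 ((Subobject.mk_factors_iff _ _).2 ⟨F'.e, F'.fac⟩)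
    exact ⟨⟨⟨{ I := I, m := I.arrow, e := I.factorThru f hI.1 },
      { lift := fun F' => Subobject.ofLEMk I F'.m (hle F')
        lift_fac := fun F' => by simp }⟩⟩⟩

/-- The formula `∃ x : A. φ` in context `Γ`, for `φ` in context `(x, Γ)`: the image of `φ` under
the projection `A × Γ ⟶ Γ`. -/
def ex {Γ : C} (A : C) (φ : Subobject (A ⊗ Γ)) : Subobject Γ :=
  imageSubobject (φ.arrow ≫ snd A Γ)

/-! ### The Heyting algebra of subobjects -/

theorem exists_bot (X : C) : ∃ B : Subobject X, ∀ S : Subobject X, B ≤ S := by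
  refine ⟨all (Ω C) (sub (fst (Ω C) X)), fun S => ?_⟩
  rw [le_iff_factors]
  intro Y z hz
  rw [all_factors] at hz
  have h := hz (z ≫ chi S) (𝟙 Y)
  rw [factors_iff_pullback, ← sub_comp, lift_fst, sub_comp, sub_chi] at h
  exact (factors_iff_pullback _ _).2 h

theorem exists_sup {X : C} (S T : Subobject X) : ∃ U : Subobject X, IsLUB {S, T} U := by
  let W : Subobject (Ω C ⊗ X) := sub (fst _ _)
  let S' : Subobject (Ω C ⊗ X) := (Subobject.pullback (snd _ _)).obj S
  let T' : Subobject (Ω C ⊗ X) := (Subobject.pullback (snd _ _)).obj T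
  refine ⟨all (Ω C) (impS (impS S' W ⊓ impS T' W) W), ?_, ?_⟩
  · rintro R (rfl | rfl)
    · rw [le_all_iff, le_impS_iff]
      exact (inf_le_inf_left _ inf_le_left).trans (by
        rw [inf_comm]; exact (le_impS_iff _ _ _).1 le_rfl)
    · rw [le_all_iff, le_impS_iff]
      exact (inf_le_inf_left _ inf_le_right).trans (by
        rw [inf_comm]; exact (le_impS_iff _ _ _).1 le_rfl)
  · intro R hR
    have hS : S ≤ R := hR (by simp)
    have hT : T ≤ R := hR (by simp)
    rw [le_iff_factors]
    intro Y z hz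
    rw [all_factors] at hz
    have h1 := hz (z ≫ chi R) (𝟙 Y)
    rw [impS_factors] at h1
    have hW : ∀ {V : C} (y : V ⟶ Y), R.Factors (y ≫ z) →
        W.Factors (y ≫ lift (z ≫ chi R) (𝟙 Y ≫ z)) := by
      intro V y h
      rw [factors_iff_pullback, ← sub_comp, Category.assoc, lift_fst, ← Category.assoc,
        sub_comp, sub_chi]
      exact (factors_iff_pullback _ _).1 h
    have h2 := h1 (𝟙 Y) (by
      rw [Subobject.inf_factors, impS_factors, impS_factors]
      constructor
      · intro V y hy
        rw [pullback_factors] at hy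
        rw [← Category.assoc]
        exact hW _ (Subobject.factors_of_le _ hS (by simpa using hy))
      · intro V y hy
        rw [pullback_factors] at hy
        rw [← Category.assoc]
        exact hW _ (Subobject.factors_of_le _ hT (by simpa using hy)))
    rw [factors_iff_pullback, ← sub_comp, Category.id_comp, lift_fst, sub_comp, sub_chi] at h2
    exact (factors_iff_pullback _ _).2 h2

/-- `Sub(X)` with its usual order is a Heyting algebra. -/
instance heytingAlgebra (X : C) : HeytingAlgebra (Subobject X) :=
  { (inferInstance : SemilatticeInf (Subobject X)),
    (inferInstance : OrderTop (Subobject X)) with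
    sup := fun S T => (exists_sup S T).choose
    le_sup_left := fun S T => (exists_sup S T).choose_spec.1 (by simp)
    le_sup_right := fun S T => (exists_sup S T).choose_spec.1 (by simp)
    sup_le := fun S T R hS hT => (exists_sup S T).choose_spec.2 (by
      rintro Q (rfl | rfl)
      · exact hS
      · exact hT)
    bot := (exists_bot X).choose
    bot_le := (exists_bot X).choose_spec
    himp := impS
    le_himp_iff := le_impS_iff
    compl := fun S => impS S (exists_bot X).choose
    himp_bot := fun _ => rfl }

/-- A topos is Boolean if all the Heyting algebras `Sub(X)` are Boolean algebras. -/
def IsBoolean (C : Type u) [Category.{v} C] [ElemTopos C] : Prop :=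
  ∀ (X : C) (S : Subobject X), S ⊔ Sᶜ = ⊤

/-! ### Internal language

A term of type `X` in context `Γ` is a morphism `Γ ⟶ X`, a formula in context `Γ` is a subobject
of `Γ`. The connectives are those of the Heyting algebra `Subobject Γ`. A context is extended on
the left, so in context `A ⊗ Γ` the new variable is `fst A Γ`, and `snd A Γ` is weakening. -/

/-- The formula `t ∈ T`. -/
def memF {Γ X : C} (t : Γ ⟶ X) (T : Γ ⟶ Pow X) : Subobject Γ :=
  (Subobject.pullback (lift t T)).obj (memRel X)

/-- The formula `A ⪯ B` for `A`, `B` of type `PX`: `∀ x. x ∈ A ⇒ x ∈ B`. -/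
def leF {Γ X : C} (A B : Γ ⟶ Pow X) : Subobject Γ :=
  all X (memF (fst X Γ) (snd X Γ ≫ A) ⇨ memF (fst X Γ) (snd X Γ ≫ B))

/-- The term `A ∧ B = {x ∣ x ∈ A ∧ x ∈ B}` of type `PX`. -/
def interT {Γ X : C} (A B : Γ ⟶ Pow X) : Γ ⟶ Pow X :=
  compr (memF (fst X Γ) (snd X Γ ≫ A) ⊓ memF (fst X Γ) (snd X Γ ≫ B))

/-- The term `X = {x ∣ true}` of type `PX`. -/
def fullT (Γ X : C) : Γ ⟶ Pow X := compr ⊤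

/-- A closed formula is valid if it is the top element of `Sub(𝟙)`. -/
def Holds (φ : Subobject (𝟙_ C)) : Prop := φ = ⊤

/-! ### Filters and structuring neighborhoods -/

/-- `∀ A. ∀ B. A ∈ F ∧ B ∈ F ⇒ A ∧ B ∈ F`, in the context `F : PPX`. -/
def filterInter (X : C) : Subobject (Pow (Pow X)) :=
  all (Pow X) (all (Pow X) (
    let B := fst (Pow X) (Pow X ⊗ Pow (Pow X))
    let A := snd (Pow X) (Pow X ⊗ Pow (Pow X)) ≫ fst _ _
    let F := snd (Pow X) (Pow X ⊗ Pow (Pow X)) ≫ snd _ _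
    memF A F ⊓ memF B F ⇨ memF (interT A B) F))

/-- `∀ A. ∀ B. A ∈ F ∧ A ⪯ B ⇒ B ∈ F`, in the context `F : PPX`. -/
def filterUpper (X : C) : Subobject (Pow (Pow X)) :=
  all (Pow X) (all (Pow X) (
    let B := fst (Pow X) (Pow X ⊗ Pow (Pow X))
    let A := snd (Pow X) (Pow X ⊗ Pow (Pow X)) ≫ fst _ _
    let F := snd (Pow X) (Pow X ⊗ Pow (Pow X)) ≫ snd _ _
    memF A F ⊓ leF A B ⇨ memF B F))

/-- `X ∈ F`, in the context `F : PPX`. -/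
def filterFull (X : C) : Subobject (Pow (Pow X)) :=
  memF (fullT (Pow (Pow X)) X) (𝟙 (Pow (Pow X)))

/-- `∀ A. A ∈ F ⇒ ∃ x. x ∈ A`, in the context `F : PPX`. -/
def filterStrict (X : C) : Subobject (Pow (Pow X)) :=
  all (Pow X) (
    let A := fst (Pow X) (Pow (Pow X))
    let F := snd (Pow X) (Pow (Pow X))
    memF A F ⇨ ex X (memF (fst X _) (snd X _ ≫ A)))

/-- The morphism `𝓕 : PPX ⟶ Ω` defined by the filter axioms. -/
def filterMor (X : C) : Pow (Pow X) ⟶ Ω C :=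
  chi (filterInter X ⊓ filterUpper X ⊓ filterFull X ⊓ filterStrict X)

/-- The formula `𝓕(F)` for a term `F` of type `PPX`. -/
def isFilterF {Γ X : C} (F : Γ ⟶ Pow (Pow X)) : Subobject Γ := sub (F ≫ filterMor X)

/-- Structuring neighborhood: `∀ x. 𝓕(N(x))` and `∀ x. ∀ A. A ∈ N(x) ⇒ x ∈ A` are valid. -/
structure IsStructuring {X : C} (N : X ⟶ Pow (Pow X)) : Prop where
  filter : Holds (all X (isFilterF (fst X (𝟙_ C) ≫ N)))
  center : Holds (all X (all (Pow X) (
    let A := fst (Pow X) (X ⊗ 𝟙_ C)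
    let x := snd (Pow X) (X ⊗ 𝟙_ C) ≫ fst _ _
    memF A (x ≫ N) ⇨ memF x A)))

/-- Topological neighborhood: a structuring neighborhood such that
`∀ x. ∀ A. A ∈ N(x) ⇒ ∃ B. B ∈ N(x) ∧ ∀ y. y ∈ B ⇒ A ∈ N(y)` is valid. -/
structure IsTopological {X : C} (N : X ⟶ Pow (Pow X)) : Prop extends IsStructuring N where
  open_core : Holds (all X (all (Pow X) (
    let A := fst (Pow X) (X ⊗ 𝟙_ C)
    let x := snd (Pow X) (X ⊗ 𝟙_ C) ≫ fst _ _
    memF A (x ≫ N) ⇨ ex (Pow X) (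
      let B := fst (Pow X) (Pow X ⊗ X ⊗ 𝟙_ C)
      let w := snd (Pow X) (Pow X ⊗ X ⊗ 𝟙_ C)
      memF B (w ≫ x ≫ N) ⊓ all X (
        let y := fst X (Pow X ⊗ Pow X ⊗ X ⊗ 𝟙_ C)
        let w' := snd X (Pow X ⊗ Pow X ⊗ X ⊗ 𝟙_ C)
        memF y (w' ≫ B) ⇨ memF (w' ≫ w ≫ A) (y ≫ N))))))

/-- Erosion `ε[N] : PX ⟶ PX`, `ε[N](Y) = {x ∣ Y ∈ N(x)}`. -/
def erosion {X : C} (N : X ⟶ Pow (Pow X)) : Pow X ⟶ Pow X :=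
  compr (
    let x := fst X (Pow X)
    let Y := snd X (Pow X)
    memF Y (x ≫ N))

/-- Dilation `δ[N] : PX ⟶ PX`, `δ[N](Y) = {x ∣ ∃ F. 𝓕(F) ∧ Y ∈ F ∧ N(x) ⪯ F}`. -/
def dilation {X : C} (N : X ⟶ Pow (Pow X)) : Pow X ⟶ Pow X :=
  compr (ex (Pow (Pow X)) (
    let F := fst (Pow (Pow X)) (X ⊗ Pow X)
    let x := snd (Pow (Pow X)) (X ⊗ Pow X) ≫ fst _ _
    let Y := snd (Pow (Pow X)) (X ⊗ Pow X) ≫ snd _ _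
    isFilterF F ⊓ memF Y F ⊓ leF (x ≫ N) F))

/-- The bijection `Hom(𝟙, PX) ≃ Sub(X)`: a global element of `PX` corresponds to the subobject of
`X ≅ X × 𝟙` classified by its transpose. -/
def globalEquiv (X : C) : (𝟙_ C ⟶ Pow X) ≃ Subobject X where
  toFun a := sub ((ρ_ X).inv ≫ MonoidalClosed.uncurry a)
  invFun S := MonoidalClosed.curry ((ρ_ X).hom ≫ chi S)
  left_inv a := by simp
  right_inv S := by simp

/-- The action on `Sub(X)` of a morphism `PX ⟶ PX`, through `Hom(𝟙, PX) ≃ Sub(X)`. -/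
def onSub {X : C} (f : Pow X ⟶ Pow X) (S : Subobject X) : Subobject X :=
  globalEquiv X ((globalEquiv X).symm S ≫ f)

/-! ### Formulas and their semantics -/

/-- Modal formulas over a set `PV` of propositional variables. -/
inductive Formula (PV : Type w) : Type w
  | top : Formula PV
  | bot : Formula PV
  | var (p : PV) : Formula PV
  | neg (φ : Formula PV) : Formula PV
  | and (φ ψ : Formula PV) : Formula PV
  | or (φ ψ : Formula PV) : Formula PV
  | imp (φ ψ : Formula PV) : Formula PV
  | box (φ : Formula PV) : Formula PV
  | dia (φ : Formula PV) : Formula PV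

/-- A model `(X, N, ν)` in the topos `C`. -/
structure Model (C : Type u) [Category.{v} C] [ElemTopos C] (PV : Type w) where
  /-- the carrier -/
  X : C
  /-- the structuring neighborhood -/
  N : X ⟶ Pow (Pow X)
  isStructuring : IsStructuring N
  /-- the valuation -/
  ν : PV → Subobject X

/-- The interpretation of formulas in a model. -/
def Model.sem {PV : Type w} (M : Model C PV) : Formula PV → Subobject M.X
  | .top => ⊤
  | .bot => ⊥
  | .var p => M.ν p
  | .neg φ => M.sem φ ⇨ ⊥
  | .and φ ψ => M.sem φ ⊓ M.sem ψ
  | .or φ ψ => M.sem φ ⊔ M.sem ψ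
  | .imp φ ψ => M.sem φ ⇨ M.sem ψ
  | .box φ => onSub (erosion M.N) (M.sem φ)
  | .dia φ => onSub (dilation M.N) (M.sem φ)

/-- The sequent `φ ⊢ ψ` is valid in `M`. -/
def Model.Valid {PV : Type w} (M : Model C PV) (φ ψ : Formula PV) : Prop :=
  M.sem φ ≤ M.sem ψ

open Formula in
/-- Derivability of the sequent `φ ⊢ ψ`. The S4 axioms are part of the calculus iff `s4` holds, and
the classical axiom is part of it iff `classical` holds. -/
inductive Derivable {PV : Type w} (s4 classical : Prop) : Formula PV → Formula PV → Prop
  | identity (φ) : Derivable s4 classical φ φ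
  | box_top_mp : Derivable s4 classical (box top) top
  | box_top_mpr : Derivable s4 classical top (box top)
  | dia_bot_mp : Derivable s4 classical (dia bot) bot
  | dia_bot_mpr : Derivable s4 classical bot (dia bot)
  | duality (φ) : Derivable s4 classical (box (neg φ)) (neg (dia φ))
  | box_and_mp (φ ψ) : Derivable s4 classical (box (and φ ψ)) (and (box φ) (box ψ))
  | box_and_mpr (φ ψ) : Derivable s4 classical (and (box φ) (box ψ)) (box (and φ ψ))
  | dia_or (φ ψ) : Derivable s4 classical (or (dia φ) (dia ψ)) (dia (or φ ψ))
  | axiomK (φ ψ) : Derivable s4 classical (box (imp φ ψ)) (imp (box φ) (box ψ))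
  | box_T (φ) : Derivable s4 classical (box φ) φ
  | dia_T (φ) : Derivable s4 classical φ (dia φ)
  | box_S4 (h : s4) (φ) : Derivable s4 classical (box φ) (box (box φ))
  | dia_S4 (h : s4) (φ) : Derivable s4 classical (dia (dia φ)) (dia φ)
  | dne (h : classical) (φ) : Derivable s4 classical (neg (neg φ)) φ
  | inconsistency (ψ) : Derivable s4 classical bot ψ
  | tautology (φ) : Derivable s4 classical φ top
  | cut {φ ψ χ} : Derivable s4 classical φ ψ → Derivable s4 classical ψ χ →
      Derivable s4 classical φ χ
  | and_left (φ ψ) : Derivable s4 classical (and φ ψ) φ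
  | and_right (φ ψ) : Derivable s4 classical (and φ ψ) ψ
  | and_self_mp (φ) : Derivable s4 classical (and φ φ) φ
  | and_self_mpr (φ) : Derivable s4 classical φ (and φ φ)
  | and_comm (φ ψ) : Derivable s4 classical (and φ ψ) (and ψ φ)
  | and_intro {φ ψ χ} : Derivable s4 classical φ ψ → Derivable s4 classical φ χ →
      Derivable s4 classical φ (and ψ χ)
  | or_left (φ ψ) : Derivable s4 classical φ (or φ ψ)
  | or_right (φ ψ) : Derivable s4 classical ψ (or φ ψ)
  | or_comm (φ ψ) : Derivable s4 classical (or φ ψ) (or ψ φ)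
  | or_elim {φ ψ χ} : Derivable s4 classical φ χ → Derivable s4 classical ψ χ →
      Derivable s4 classical (or φ ψ) χ
  | or_elim_inv_left {φ ψ χ} : Derivable s4 classical (or φ ψ) χ → Derivable s4 classical φ χ
  | or_elim_inv_right {φ ψ χ} : Derivable s4 classical (or φ ψ) χ → Derivable s4 classical ψ χ
  | distrib_mp (φ ψ χ) :
      Derivable s4 classical (and φ (or ψ χ)) (or (and φ ψ) (and φ χ))
  | distrib_mpr (φ ψ χ) :
      Derivable s4 classical (or (and φ ψ) (and φ χ)) (and φ (or ψ χ))
  | imp_intro {φ ψ χ} : Derivable s4 classical (and φ ψ) χ → Derivable s4 classical φ (imp ψ χ)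
  | imp_elim {φ ψ χ} : Derivable s4 classical φ (imp ψ χ) → Derivable s4 classical (and φ ψ) χ
  | neg_mp (φ) : Derivable s4 classical (neg φ) (imp φ bot)
  | neg_mpr (φ) : Derivable s4 classical (imp φ bot) (neg φ)
  | box_mono {φ ψ} : Derivable s4 classical φ ψ → Derivable s4 classical (box φ) (box ψ)
  | dia_mono {φ ψ} : Derivable s4 classical φ ψ → Derivable s4 classical (dia φ) (dia ψ)

end

end ElemTopos

namespace ElemTopos

noncomputable section

variable {C : Type u} [Category.{v} C] [ElemTopos C]

/-! ### Forcing clauses for the connectives and quantifiers -/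

/-! Each internal formula is read at all stages: a subobject `S` of `X` is known through the
generalized elements `z : Y ⟶ X` that factor through it. In this reading `⇨` and `∀` become
quantification over later stages. For `⊥` and `∃` no covers are needed: quantifying along a morphism
turns the goal into a subobject of the context, which can then be compared with `⊥` or with an image
(`bot_elim`, `ex_elim`). Elementwise arguments about filters therefore apply in any topos.

The central fact is `IsStructuring.mem_comp_dilation`: `x` lies in the dilation of `Y` iff every
neighborhood of `x` meets `Y`. A strict filter containing both `N(x)` and `Y` forces this.
Conversely, if every neighborhood meets `Y`, the filter generated by `N(x)` and `Y` is strict.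

The modal axioms then become short facts about neighborhoods. The filter laws give the axioms for
`□`; centering gives both T axioms; `erosion_inf_dilation_le` together with `dilation_bot` gives the
duality axiom; an open core inside each neighborhood gives the S4 axioms. The remaining rules are
Heyting algebra, and excluded middle in each `Sub(X)` gives the classical axiom. Soundness follows
by induction on derivations. -/

/-- Universal quantification of a subobject along an arbitrary morphism. -/
def allAlong {Δ Γ : C} (z : Δ ⟶ Γ) (T : Subobject Δ) : Subobject Γ :=
  all Δ (eqF (fst Δ Γ ≫ z) (snd Δ Γ) ⇨ (Subobject.pullback (fst Δ Γ)).obj T)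

theorem himp_factors {X Y : C} (S T : Subobject X) (z : Y ⟶ X) :
    (S ⇨ T).Factors z ↔ ∀ {W : C} (y : W ⟶ Y), S.Factors (y ≫ z) → T.Factors (y ≫ z) :=
  impS_factors S T z

/-- The implication adds no further change of stage: `∀` already ranges over every later stage, and
restricting `a` and `y` along `v` gives another instance of the same quantifier. -/
theorem all_himp_factors {Γ A Δ : C} (φ ψ : Subobject (A ⊗ Γ)) (z : Δ ⟶ Γ) :
    (all A (φ ⇨ ψ)).Factors z ↔ ∀ {W : C} (a : W ⟶ A) (y : W ⟶ Δ),
      φ.Factors (lift a (y ≫ z)) → ψ.Factors (lift a (y ≫ z)) := by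
  rw [all_factors]
  constructor
  · intro h W a y hφ
    simpa using (himp_factors _ _ _).1 (h a y) (𝟙 W) (by simpa using hφ)
  · intro h W a y
    rw [himp_factors]
    intro V v hv
    have e : v ≫ lift a (y ≫ z) = lift (v ≫ a) ((v ≫ y) ≫ z) := by simp
    rw [e] at hv ⊢
    exact h _ _ hv

theorem all_all_himp_factors {Γ A B Δ : C} (φ ψ : Subobject (B ⊗ A ⊗ Γ)) (z : Δ ⟶ Γ) :
    (all A (all B (φ ⇨ ψ))).Factors z ↔ ∀ {W : C} (a : W ⟶ A) (b : W ⟶ B) (y : W ⟶ Δ),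
      φ.Factors (lift b (lift a (y ≫ z))) → ψ.Factors (lift b (lift a (y ≫ z))) := by
  rw [all_factors]
  constructor
  · intro h W a b y hφ
    simpa using (all_himp_factors _ _ _).1 (h a y) b (𝟙 W) (by simpa using hφ)
  · intro h W a y
    rw [all_himp_factors]
    intro V b v hv
    have e : v ≫ lift a (y ≫ z) = lift (v ≫ a) ((v ≫ y) ≫ z) := by simp
    rw [e] at hv ⊢
    exact h _ _ _ hv

theorem allAlong_factors {Δ Γ Z : C} (z : Δ ⟶ Γ) (T : Subobject Δ) (w : Z ⟶ Γ) :
    (allAlong z T).Factors w ↔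
      ∀ {W : C} (a : W ⟶ Δ) (y : W ⟶ Z), a ≫ z = y ≫ w → T.Factors a := by
  rw [allAlong, all_himp_factors]
  simp only [eqF_factors, pullback_factors, lift_fst_assoc, lift_fst, lift_snd]

/-- Ex falso for a goal over an unrelated object `Z`: `allAlong z` carries the goal to a subobject
of `X`, and `⊥` lies below it. -/
theorem bot_elim {X Y Z : C} {z : Y ⟶ X} (h : (⊥ : Subobject X).Factors z) (T : Subobject Z)
    (t : Y ⟶ Z) : T.Factors t := by
  have h' := Subobject.factors_of_le z
    (bot_le : ⊥ ≤ allAlong z ((Subobject.pullback t).obj T)) h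
  simpa [pullback_factors] using (allAlong_factors _ _ _).1 h' (𝟙 Y) (𝟙 Y) rfl

theorem ex_factors_of_factors {Γ A Δ : C} {φ : Subobject (A ⊗ Γ)} {z : Δ ⟶ Γ} (a : Δ ⟶ A)
    (h : φ.Factors (lift a z)) : (ex A φ).Factors z := by
  have hz : z = φ.factorThru _ h ≫ φ.arrow ≫ snd A Γ := by simp
  rw [hz]
  exact imageSubobject_factors_comp_self (φ.arrow ≫ snd A Γ) _

theorem ex_le {Γ A : C} {φ : Subobject (A ⊗ Γ)} {T : Subobject Γ}
    (h : ∀ {W : C} (a : W ⟶ A) (y : W ⟶ Γ), φ.Factors (lift a y) → T.Factors y) :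
    ex A φ ≤ T := by
  have hT : T.Factors (φ.arrow ≫ snd A Γ) :=
    h (φ.arrow ≫ fst A Γ) _ (by
      have e : lift (φ.arrow ≫ fst A Γ) (φ.arrow ≫ snd A Γ) = φ.arrow := by ext <;> simp
      rw [e]
      exact φ.factors_self)
  exact imageSubobject_le _ (T.factorThru _ hT) (by simp)

/-- Elimination of the existential quantifier, with a goal over the same stage `Δ`. -/
theorem ex_elim {Γ A Δ Z : C} {φ : Subobject (A ⊗ Γ)} {z : Δ ⟶ Γ} (h : (ex A φ).Factors z)
    {T : Subobject Z} {t : Δ ⟶ Z}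
    (H : ∀ {W : C} (a : W ⟶ A) (y : W ⟶ Δ), φ.Factors (lift a (y ≫ z)) → T.Factors (y ≫ t)) :
    T.Factors t := by
  -- Minimality of the image applies only to subobjects of `Γ`, so the goal is first carried there
  -- by `∀` along `z`. This plays the role of pullback-stability of images.
  have hle : ex A φ ≤ allAlong z ((Subobject.pullback t).obj T) := ex_le fun a y hφ => by
    rw [allAlong_factors]
    intro V b v hb
    rw [pullback_factors]
    refine H (v ≫ a) b ?_
    rw [hb, ← comp_lift]
    exact factors_precomp hφ v
  simpa [pullback_factors] using
    (allAlong_factors _ _ _).1 (Subobject.factors_of_le z hle h) (𝟙 Δ) (𝟙 Δ) rfl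

/-! ### Membership at a stage -/

/-- The generalized element `t` belongs to the generalized subobject `T`. -/
def Mem {Γ X : C} (t : Γ ⟶ X) (T : Γ ⟶ Pow X) : Prop := (memRel X).Factors (lift t T)

/-- Inclusion of generalized subobjects. -/
structure Incl {Γ X : C} (A B : Γ ⟶ Pow X) : Prop where
  imp : ∀ {W : C} (t : W ⟶ X) (y : W ⟶ Γ), Mem t (y ≫ A) → Mem t (y ≫ B)

/-- The generalized subobject `A` is internally inhabited. -/
def Inhab {Γ X : C} (A : Γ ⟶ Pow X) : Prop := (ex X (memRel X)).Factors A

theorem Mem.precomp {Γ Δ X : C} {t : Γ ⟶ X} {T : Γ ⟶ Pow X} (h : Mem t T) (y : Δ ⟶ Γ) :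
    Mem (y ≫ t) (y ≫ T) := by
  rw [Mem, ← comp_lift]
  exact factors_precomp h y

theorem Incl.precomp {Γ Δ X : C} {A B : Γ ⟶ Pow X} (h : Incl A B) (y : Δ ⟶ Γ) :
    Incl (y ≫ A) (y ≫ B) := by
  refine ⟨fun t v ht => ?_⟩
  simpa using h.imp t (v ≫ y) (by simpa using ht)

theorem Incl.mem {Γ X : C} {A B : Γ ⟶ Pow X} (h : Incl A B) {t : Γ ⟶ X} (ht : Mem t A) :
    Mem t B := by
  simpa using h.imp t (𝟙 Γ) (by simpa using ht)

theorem Mem.inhab {Γ X : C} {t : Γ ⟶ X} {A : Γ ⟶ Pow X} (h : Mem t A) : Inhab A :=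
  ex_factors_of_factors t h

theorem Inhab.elim {Γ X Z : C} {A : Γ ⟶ Pow X} (h : Inhab A) {T : Subobject Z} {t : Γ ⟶ Z}
    (H : ∀ {W : C} (a : W ⟶ X) (y : W ⟶ Γ), Mem a (y ≫ A) → T.Factors (y ≫ t)) :
    T.Factors t :=
  ex_elim h H

theorem Inhab.mono {Γ X : C} {A B : Γ ⟶ Pow X} (h : Inhab A) (hAB : Incl A B) : Inhab B :=
  h.elim fun a y ha => (hAB.imp a y ha).inhab

theorem memF_factors {Γ Δ X : C} (t : Γ ⟶ X) (T : Γ ⟶ Pow X) (z : Δ ⟶ Γ) :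
    (memF t T).Factors z ↔ Mem (z ≫ t) (z ≫ T) := by
  rw [memF, pullback_factors, comp_lift, Mem]

theorem mem_comp_compr {Γ Δ X : C} (φ : Subobject (X ⊗ Γ)) (t : Δ ⟶ X) (z : Δ ⟶ Γ) :
    Mem t (z ≫ compr φ) ↔ φ.Factors (lift t z) := by
  rw [Mem, ← lift_whiskerLeft, ← pullback_factors, (pullback_memRel_eq_iff φ _).2 rfl]

/-- Extensionality: a morphism into `Pow X` is determined by the pullback of `memRel X`, and mutual
inclusion makes the two pullbacks equal. -/
theorem pow_ext {Γ X : C} {A B : Γ ⟶ Pow X} (h₁ : Incl A B) (h₂ : Incl B A) : A = B := by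
  rw [(pullback_memRel_eq_iff _ A).1 rfl]
  refine ((pullback_memRel_eq_iff _ B).1 ?_).symm
  refine le_antisymm ?_ ?_ <;> rw [le_iff_factors] <;> intro Y z hz <;>
    rw [pullback_factors] at hz ⊢ <;>
    have e : ∀ R : Γ ⟶ Pow X, z ≫ X ◁ R = lift (z ≫ fst _ _) ((z ≫ snd _ _) ≫ R) := by
      intro R; ext <;> simp
  · rw [e] at hz ⊢
    exact h₂.imp _ _ hz
  · rw [e] at hz ⊢
    exact h₁.imp _ _ hz

theorem leF_factors {Γ Δ X : C} (A B : Γ ⟶ Pow X) (z : Δ ⟶ Γ) :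
    (leF A B).Factors z ↔ Incl (z ≫ A) (z ≫ B) := by
  rw [leF, all_himp_factors]
  simp only [memF_factors, lift_fst, lift_snd_assoc, Category.assoc]
  exact ⟨fun h => ⟨h⟩, fun h => h.imp⟩

theorem ex_mem_factors {Γ Δ X : C} (A : Γ ⟶ Pow X) (z : Δ ⟶ Γ) :
    (ex X (memF (fst X Γ) (snd X Γ ≫ A))).Factors z ↔ Inhab (z ≫ A) := by
  constructor
  · intro h
    refine ex_elim h fun a y ha => ?_
    rw [memF_factors] at ha
    exact Mem.inhab (t := a) (by simpa using ha)
  · intro h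
    refine h.elim fun a y ha => ex_factors_of_factors a ?_
    rw [memF_factors]
    simpa using ha

theorem mem_comp_interT {Γ Δ X : C} (A B : Γ ⟶ Pow X) (t : Δ ⟶ X) (z : Δ ⟶ Γ) :
    Mem t (z ≫ interT A B) ↔ Mem t (z ≫ A) ∧ Mem t (z ≫ B) := by
  rw [interT, mem_comp_compr, Subobject.inf_factors, memF_factors, memF_factors]
  simp

/-- Substitution commutes with the term; by extensionality it is enough that both sides have the
same members. -/
theorem comp_interT {Γ Δ X : C} (A B : Γ ⟶ Pow X) (z : Δ ⟶ Γ) :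
    z ≫ interT A B = interT (z ≫ A) (z ≫ B) := by
  refine pow_ext ⟨fun t y ht => ?_⟩ ⟨fun t y ht => ?_⟩
  · rw [← Category.assoc, mem_comp_interT] at ht
    simpa [mem_comp_interT] using ht
  · rw [← Category.assoc, mem_comp_interT]
    simpa [mem_comp_interT] using ht

theorem mem_comp_fullT {Γ Δ X : C} (t : Δ ⟶ X) (z : Δ ⟶ Γ) : Mem t (z ≫ fullT Γ X) := by
  rw [fullT, mem_comp_compr]
  exact Subobject.top_factors _

theorem comp_fullT {Γ Δ X : C} (z : Δ ⟶ Γ) : z ≫ fullT Γ X = fullT Δ X := by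
  refine pow_ext ⟨fun t y _ => ?_⟩ ⟨fun t y _ => ?_⟩
  · exact mem_comp_fullT t y
  · rw [← Category.assoc]
    exact mem_comp_fullT t _

/-! ### Filters at a stage -/

/-- The generalized element `F` of `PPX` is a strict filter. -/
structure IsFilter {Γ X : C} (F : Γ ⟶ Pow (Pow X)) : Prop where
  inter : ∀ {W : C} (A B : W ⟶ Pow X) (y : W ⟶ Γ), Mem A (y ≫ F) → Mem B (y ≫ F) →
    Mem (interT A B) (y ≫ F)
  upper : ∀ {W : C} (A B : W ⟶ Pow X) (y : W ⟶ Γ), Mem A (y ≫ F) → Incl A B → Mem B (y ≫ F)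
  full : Mem (fullT Γ X) F
  strict : ∀ {W : C} (A : W ⟶ Pow X) (y : W ⟶ Γ), Mem A (y ≫ F) → Inhab A

theorem isFilterF_factors {Γ Δ X : C} (F : Γ ⟶ Pow (Pow X)) (z : Δ ⟶ Γ) :
    (isFilterF F).Factors z ↔ IsFilter (z ≫ F) := by
  have h₁ : (filterInter X).Factors (z ≫ F) ↔ ∀ {W : C} (A B : W ⟶ Pow X) (y : W ⟶ Δ),
      Mem A (y ≫ z ≫ F) → Mem B (y ≫ z ≫ F) → Mem (interT A B) (y ≫ z ≫ F) := by
    rw [filterInter, all_all_himp_factors]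
    simp [memF_factors, Subobject.inf_factors, comp_interT]
  have h₂ : (filterUpper X).Factors (z ≫ F) ↔ ∀ {W : C} (A B : W ⟶ Pow X) (y : W ⟶ Δ),
      Mem A (y ≫ z ≫ F) → Incl A B → Mem B (y ≫ z ≫ F) := by
    rw [filterUpper, all_all_himp_factors]
    simp [memF_factors, Subobject.inf_factors, leF_factors]
  have h₃ : (filterFull X).Factors (z ≫ F) ↔ Mem (fullT Δ X) (z ≫ F) := by
    rw [filterFull, memF_factors, comp_fullT, Category.comp_id]
  have h₄ : (filterStrict X).Factors (z ≫ F) ↔ ∀ {W : C} (A : W ⟶ Pow X) (y : W ⟶ Δ),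
      Mem A (y ≫ z ≫ F) → Inhab A := by
    rw [filterStrict, all_himp_factors]
    simp [memF_factors, ex_mem_factors]
  rw [isFilterF, sub_comp, pullback_factors, filterMor, sub_chi, Subobject.inf_factors,
    Subobject.inf_factors, Subobject.inf_factors, h₁, h₂, h₃, h₄]
  exact ⟨fun h => ⟨h.1.1.1, h.1.1.2, h.1.2, h.2⟩,
    fun h => ⟨⟨⟨h.inter, h.upper⟩, h.full⟩, h.strict⟩⟩

/-! ### Structuring and topological neighborhoods at a stage -/

theorem Holds.factors {φ : Subobject (𝟙_ C)} (h : Holds φ) {Δ : C} (z : Δ ⟶ 𝟙_ C) :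
    φ.Factors z := by
  rw [h]
  exact Subobject.top_factors _

section Neighborhoods

variable {X : C} {N : X ⟶ Pow (Pow X)}

theorem IsStructuring.isFilter (h : IsStructuring N) {Γ : C} (x : Γ ⟶ X) :
    IsFilter (x ≫ N) := by
  have h' := (all_factors _ _).1 (h.filter.factors (toUnit Γ)) x (𝟙 Γ)
  rw [isFilterF_factors] at h'
  simpa using h'

theorem IsStructuring.mem_of_mem (h : IsStructuring N) {Γ : C} {x : Γ ⟶ X} {A : Γ ⟶ Pow X}
    (hA : Mem A (x ≫ N)) : Mem x A := by
  have h' := (all_all_himp_factors _ _ _).1 (h.center.factors (toUnit Γ)) x A (𝟙 Γ)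
  simp only [memF_factors] at h'
  simpa using h' (by simpa using hA)

/-- The open core `B` exists only internally, so it cannot be chosen at stage `Γ`. It is available
at later stages `W`, towards a goal that is itself a factorization. -/
theorem IsTopological.elim (h : IsTopological N) {Γ : C} {x : Γ ⟶ X} {A : Γ ⟶ Pow X}
    (hA : Mem A (x ≫ N)) {Z : C} {T : Subobject Z} {t : Γ ⟶ Z}
    (H : ∀ {W : C} (B : W ⟶ Pow X) (y : W ⟶ Γ), Mem B (y ≫ x ≫ N) →
      (∀ {V : C} (b : V ⟶ X) (v : V ⟶ W), Mem b (v ≫ B) → Mem (v ≫ y ≫ A) (b ≫ N)) →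
      T.Factors (y ≫ t)) : T.Factors t := by
  have h' := (all_all_himp_factors _ _ _).1 (h.open_core.factors (toUnit Γ)) x A (𝟙 Γ)
    (by rw [memF_factors]; simpa using hA)
  refine ex_elim h' fun B y hB => ?_
  rw [Subobject.inf_factors, all_himp_factors] at hB
  simp only [memF_factors] at hB
  refine H B y (by simpa using hB.1) fun b v hb => ?_
  simpa using hB.2 b v (by simpa using hb)

theorem mem_comp_erosion {Γ : C} (x : Γ ⟶ X) (Y : Γ ⟶ Pow X) :
    Mem x (Y ≫ erosion N) ↔ Mem Y (x ≫ N) := by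
  rw [erosion, mem_comp_compr, memF_factors]
  simp

/-! ### Generated filters and the description of the dilation -/

/-- The filter generated by a filter `F` and a subobject `Y`. -/
def adjoin {Γ : C} (F : Γ ⟶ Pow (Pow X)) (Y : Γ ⟶ Pow X) : Γ ⟶ Pow (Pow X) :=
  compr (ex (Pow X) (
    let A := fst (Pow X) (Pow X ⊗ Γ)
    let B := snd (Pow X) (Pow X ⊗ Γ) ≫ fst _ _
    let w := snd (Pow X) (Pow X ⊗ Γ) ≫ snd _ _
    memF A (w ≫ F) ⊓ leF (interT A (w ≫ Y)) B))

theorem mem_adjoin {Γ Δ : C} {F : Γ ⟶ Pow (Pow X)} {Y : Γ ⟶ Pow X} {A B : Δ ⟶ Pow X}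
    {y : Δ ⟶ Γ} (hA : Mem A (y ≫ F)) (hB : Incl (interT A (y ≫ Y)) B) :
    Mem B (y ≫ adjoin F Y) := by
  rw [adjoin, mem_comp_compr]
  refine ex_factors_of_factors A ?_
  rw [Subobject.inf_factors, memF_factors, leF_factors, comp_interT]
  exact ⟨by simpa using hA, by simpa using hB⟩

theorem mem_adjoin_elim {Γ Δ : C} {F : Γ ⟶ Pow (Pow X)} {Y : Γ ⟶ Pow X} {B : Δ ⟶ Pow X}
    {y : Δ ⟶ Γ} (h : Mem B (y ≫ adjoin F Y)) {Z : C} {T : Subobject Z} {t : Δ ⟶ Z}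
    (H : ∀ {W : C} (A : W ⟶ Pow X) (v : W ⟶ Δ), Mem A (v ≫ y ≫ F) →
      Incl (interT A (v ≫ y ≫ Y)) (v ≫ B) → T.Factors (v ≫ t)) : T.Factors t := by
  rw [adjoin, mem_comp_compr] at h
  refine ex_elim h fun A v hA => ?_
  rw [Subobject.inf_factors, memF_factors, leF_factors, comp_interT] at hA
  exact H A v (by simpa using hA.1) (by simpa using hA.2)

theorem incl_adjoin {Γ : C} (F : Γ ⟶ Pow (Pow X)) (Y : Γ ⟶ Pow X) : Incl F (adjoin F Y) := by
  exact ⟨fun A y hA => mem_adjoin hA ⟨fun t v ht => ((mem_comp_interT _ _ _ _).1 ht).1⟩⟩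

theorem IsFilter.mem_adjoin_self {Γ : C} {F : Γ ⟶ Pow (Pow X)} (hF : IsFilter F)
    (Y : Γ ⟶ Pow X) : Mem Y (adjoin F Y) := by
  -- The member of `F` used here is the whole of `X`, whose intersection with `Y` is contained in
  -- `Y`.
  have h : Mem Y (𝟙 Γ ≫ adjoin F Y) :=
    mem_adjoin (by simpa using hF.full) ⟨fun t v ht => by
      simpa using ((mem_comp_interT _ _ _ _).1 ht).2⟩
  simpa using h

/-- The hypothesis `hY` is needed only for strictness: a member of the generated filter contains
some `A ∩ Y` with `A` in `F`, and `hY` makes that intersection inhabited. -/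
theorem IsFilter.adjoin {Γ : C} {F : Γ ⟶ Pow (Pow X)} (hF : IsFilter F) {Y : Γ ⟶ Pow X}
    (hY : ∀ {W : C} (A : W ⟶ Pow X) (y : W ⟶ Γ), Mem A (y ≫ F) → Inhab (interT A (y ≫ Y))) :
    IsFilter (adjoin F Y) where
  inter A B y hA hB := by
    refine mem_adjoin_elim hA fun A' v hA' hAA' => ?_
    -- A `Mem` goal is a factorization of a `lift`, so the elimination restricts the whole pair
    -- along `v`; `comp_lift` separates the components again.
    rw [comp_lift, comp_interT, ← Category.assoc]
    have hB' := hB.precomp v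
    rw [← Category.assoc] at hB'
    refine mem_adjoin_elim hB' fun B' w hB' hBB' => ?_
    rw [comp_lift, comp_interT]
    simp only [← Category.assoc]
    -- From `A' ∩ Y ⪯ A` and `B' ∩ Y ⪯ B` one gets `(A' ∩ B') ∩ Y ⪯ A ∩ B`.
    refine mem_adjoin (A := interT (w ≫ A') B') (y := (w ≫ v) ≫ y) (hF.inter _ _ _ ?_ ?_)
      ⟨fun t z ht => ?_⟩
    · simpa using hA'.precomp w
    · simpa using hB'
    · simp only [mem_comp_interT] at ht ⊢
      constructor
      · have := hAA'.imp t (z ≫ w) (by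
          rw [mem_comp_interT]
          exact ⟨by simpa using ht.1.1, by simpa using ht.2⟩)
        simpa using this
      · rw [Category.assoc w v B]
        refine hBB'.imp t z ?_
        rw [mem_comp_interT]
        exact ⟨ht.1.2, by simpa using ht.2⟩
  upper A B y hA hAB := by
    refine mem_adjoin_elim hA fun A' v hA' hAA' => ?_
    rw [comp_lift, ← Category.assoc]
    refine mem_adjoin (by simpa using hA') ⟨fun t w ht => ?_⟩
    exact (hAB.precomp v).imp t w (hAA'.imp t w (by simpa using ht))
  full := (incl_adjoin F Y).mem hF.full
  strict A y hA := by
    refine mem_adjoin_elim hA fun A' v hA' hAA' => ?_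
    have h := hY A' (v ≫ y) (by simpa using hA')
    exact h.mono (by simpa using hAA')

/-- `x` lies in the dilation of `Y` iff every neighborhood of `x` meets `Y`. -/
theorem IsStructuring.mem_comp_dilation (h : IsStructuring N) {Γ : C} (x : Γ ⟶ X)
    (Y : Γ ⟶ Pow X) :
    Mem x (Y ≫ dilation N) ↔ ∀ {W : C} (A : W ⟶ Pow X) (y : W ⟶ Γ),
      Mem A (y ≫ x ≫ N) → Inhab (interT A (y ≫ Y)) := by
  rw [dilation, mem_comp_compr]
  constructor
  · intro hx W A y hA
    refine ex_elim (factors_precomp hx y) fun F v hF => ?_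
    rw [Subobject.inf_factors, Subobject.inf_factors, isFilterF_factors, memF_factors,
      leF_factors] at hF
    obtain ⟨⟨hF, hYF⟩, hNF⟩ := hF
    -- Both `A` and `Y` belong to the strict filter `F`, hence so does their intersection, which is
    -- therefore inhabited.
    have hI := hF.inter (v ≫ A) (v ≫ y ≫ Y) (𝟙 _) (hNF.imp _ (𝟙 _) ?_) ?_
    · rw [comp_interT]
      exact hF.strict _ _ hI
    · simpa using hA.precomp v
    · simpa using hYF
  · intro hx
    -- The witness is the least candidate, the filter generated by `N(x)` and `Y`; `hx` is exactly
    -- what makes it strict.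
    refine ex_factors_of_factors (ElemTopos.adjoin (x ≫ N) Y) ?_
    rw [Subobject.inf_factors, Subobject.inf_factors, isFilterF_factors, memF_factors,
      leF_factors]
    refine ⟨⟨?_, ?_⟩, ?_⟩
    · simpa using (h.isFilter x).adjoin hx
    · simpa using (h.isFilter x).mem_adjoin_self Y
    · simpa using incl_adjoin (x ≫ N) Y

theorem mem_comp_dilation_of_mem (h : IsStructuring N) {Γ : C} {x : Γ ⟶ X} {Y : Γ ⟶ Pow X}
    (hx : Mem x Y) : Mem x (Y ≫ dilation N) := by
  rw [h.mem_comp_dilation]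
  intro W A y hA
  refine Mem.inhab (t := y ≫ x) ?_
  -- `mem_comp_interT` speaks of restricted terms, so an identity is inserted to match it.
  rw [← Category.id_comp (interT _ _), mem_comp_interT, Category.id_comp, Category.id_comp]
  exact ⟨h.mem_of_mem (by simpa using hA), hx.precomp y⟩

/-- The open core of the neighborhood `Y` of `x` is contained in the erosion of `Y`, which is then a
neighborhood of `x` by upward closure. -/
theorem mem_erosion_erosion (h : IsTopological N) {Γ : C} {x : Γ ⟶ X} {Y : Γ ⟶ Pow X}
    (hx : Mem x (Y ≫ erosion N)) : Mem x (Y ≫ erosion N ≫ erosion N) := by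
  rw [mem_comp_erosion] at hx
  rw [← Category.assoc, mem_comp_erosion]
  refine h.elim hx fun B y hB hBY => ?_
  rw [comp_lift]
  refine (h.isFilter x).upper B _ y hB ⟨fun b v hb => ?_⟩
  rw [← Category.assoc, ← Category.assoc, mem_comp_erosion]
  simpa using hBY b v hb

/-- Given a neighborhood `A` of `x`, its open core meets the dilation of `Y` at some `b`. Then `A`
is also a neighborhood of `b`, so `A` meets `Y`. -/
theorem mem_dilation_of_dilation_dilation (h : IsTopological N) {Γ : C} {x : Γ ⟶ X}
    {Y : Γ ⟶ Pow X} (hx : Mem x (Y ≫ dilation N ≫ dilation N)) : Mem x (Y ≫ dilation N) := by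
  rw [← Category.assoc, h.mem_comp_dilation] at hx
  rw [h.mem_comp_dilation]
  intro W A y hA
  have hA' : Mem A ((y ≫ x) ≫ N) := by simpa using hA
  refine h.elim hA' fun B v hB hBA => ?_
  refine (hx B (v ≫ y) (by simpa using hB)).elim fun b w hb => ?_
  rw [mem_comp_interT, ← Category.assoc, ← Category.assoc, h.mem_comp_dilation] at hb
  rw [← Category.assoc, comp_interT]
  have hI := hb.2 (w ≫ v ≫ A) (𝟙 _) (by simpa using hBA b w hb.1)
  simpa [Inhab] using hI

end Neighborhoods

/-! ### The maps induced on subobjects -/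

/-- The generalized subobject over `Γ` that is constantly `S`. -/
def const {X : C} (Γ : C) (S : Subobject X) : Γ ⟶ Pow X := toUnit Γ ≫ (globalEquiv X).symm S

theorem comp_const {X Γ Δ : C} (z : Δ ⟶ Γ) (S : Subobject X) : z ≫ const Γ S = const Δ S := by
  simp [const]

theorem globalEquiv_factors {X Γ : C} (a : 𝟙_ C ⟶ Pow X) (x : Γ ⟶ X) :
    (globalEquiv X a).Factors x ↔ Mem x (toUnit Γ ≫ a) := by
  have e : x ≫ (ρ_ X).inv = lift x (toUnit Γ) := by ext; simp
  change (sub ((ρ_ X).inv ≫ MonoidalClosed.uncurry a)).Factors x ↔ _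
  rw [sub_comp, pullback_factors, ← pullback_memRel, pullback_factors, e, lift_whiskerLeft, Mem]

theorem mem_const {X Γ : C} (x : Γ ⟶ X) (S : Subobject X) : Mem x (const Γ S) ↔ S.Factors x := by
  rw [const, ← globalEquiv_factors, Equiv.apply_symm_apply]

theorem onSub_factors {X Γ : C} (f : Pow X ⟶ Pow X) (S : Subobject X) (x : Γ ⟶ X) :
    (onSub f S).Factors x ↔ Mem x (const Γ S ≫ f) := by
  rw [onSub, globalEquiv_factors, const, Category.assoc]

/-- Turns an iterated modality into a composite of morphisms `Pow X ⟶ Pow X`, the form in which the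
S4 facts are proved. -/
theorem const_onSub {X : C} (Γ : C) (f : Pow X ⟶ Pow X) (S : Subobject X) :
    const Γ (onSub f S) = const Γ S ≫ f := by
  rw [const, onSub, Equiv.symm_apply_apply, const, Category.assoc]

theorem incl_const {X : C} (Γ : C) {S T : Subobject X} (h : S ≤ T) :
    Incl (const Γ S) (const Γ T) := by
  refine ⟨fun t y ht => ?_⟩
  rw [comp_const, mem_const] at ht ⊢
  exact Subobject.factors_of_le _ h ht

theorem interT_const {X Γ : C} (S T : Subobject X) :
    interT (const Γ S) (const Γ T) = const Γ (S ⊓ T) := by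
  refine pow_ext ⟨fun t y ht => ?_⟩ ⟨fun t y ht => ?_⟩ <;>
    simpa only [mem_comp_interT, comp_const, mem_const, Subobject.inf_factors] using ht

theorem fullT_eq_const (X Γ : C) : fullT Γ X = const Γ ⊤ := by
  refine pow_ext ⟨fun t y _ => ?_⟩ ⟨fun t y _ => mem_comp_fullT t y⟩
  rw [comp_const, mem_const]
  exact Subobject.top_factors _

/-! ### Validity of the modal axioms in `Sub(X)` -/

section Modalities

variable {X : C} {N : X ⟶ Pow (Pow X)}

theorem onSub_erosion_factors {Γ : C} (S : Subobject X) (x : Γ ⟶ X) :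
    (onSub (erosion N) S).Factors x ↔ Mem (const Γ S) (x ≫ N) := by
  rw [onSub_factors, mem_comp_erosion]

theorem onSub_dilation_factors (h : IsStructuring N) {Γ : C} (S : Subobject X) (x : Γ ⟶ X) :
    (onSub (dilation N) S).Factors x ↔ ∀ {W : C} (A : W ⟶ Pow X) (y : W ⟶ Γ),
      Mem A (y ≫ x ≫ N) → Inhab (interT A (const W S)) := by
  rw [onSub_factors, h.mem_comp_dilation]
  simp only [comp_const]

theorem erosion_mono (h : IsStructuring N) {S T : Subobject X} (hST : S ≤ T) :
    onSub (erosion N) S ≤ onSub (erosion N) T := by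
  rw [le_iff_factors]
  intro Y z hz
  rw [onSub_erosion_factors] at hz ⊢
  simpa using (h.isFilter z).upper _ _ (𝟙 Y) (by simpa using hz) (incl_const Y hST)

theorem erosion_top (h : IsStructuring N) : onSub (erosion N) ⊤ = ⊤ := by
  rw [eq_top_iff, le_iff_factors]
  intro Y z _
  rw [onSub_erosion_factors, ← fullT_eq_const]
  exact (h.isFilter z).full

theorem erosion_inf (h : IsStructuring N) (S T : Subobject X) :
    onSub (erosion N) (S ⊓ T) = onSub (erosion N) S ⊓ onSub (erosion N) T := by
  refine le_antisymm (le_inf (erosion_mono h inf_le_left) (erosion_mono h inf_le_right)) ?_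
  rw [le_iff_factors]
  intro Y z hz
  rw [Subobject.inf_factors, onSub_erosion_factors, onSub_erosion_factors] at hz
  rw [onSub_erosion_factors, ← interT_const]
  simpa using (h.isFilter z).inter _ _ (𝟙 Y) (by simpa using hz.1) (by simpa using hz.2)

theorem erosion_himp (h : IsStructuring N) (S T : Subobject X) :
    onSub (erosion N) (S ⇨ T) ≤ onSub (erosion N) S ⇨ onSub (erosion N) T := by
  rw [le_himp_iff, ← erosion_inf h]
  exact erosion_mono h himp_inf_le

theorem erosion_le (h : IsStructuring N) (S : Subobject X) : onSub (erosion N) S ≤ S := by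
  rw [le_iff_factors]
  intro Y z hz
  rw [onSub_erosion_factors] at hz
  exact (mem_const _ _).1 (h.mem_of_mem hz)

theorem dilation_mono (h : IsStructuring N) {S T : Subobject X} (hST : S ≤ T) :
    onSub (dilation N) S ≤ onSub (dilation N) T := by
  rw [le_iff_factors]
  intro Y z hz
  rw [onSub_dilation_factors h] at hz ⊢
  intro W A y hA
  refine (hz A y hA).mono ⟨fun t v ht => ?_⟩
  rw [mem_comp_interT] at ht ⊢
  exact ⟨ht.1, (incl_const W hST).imp t v ht.2⟩

theorem le_dilation (h : IsStructuring N) (S : Subobject X) : S ≤ onSub (dilation N) S := by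
  rw [le_iff_factors]
  intro Y z hz
  rw [onSub_factors]
  exact mem_comp_dilation_of_mem h ((mem_const _ _).2 hz)

/-- If `S` is a neighborhood of a point, then so is `A ∩ S` for each neighborhood `A`; hence `A ∩ S`
meets `T`, that is, `A` meets `S ∩ T`. -/
theorem erosion_inf_dilation_le (h : IsStructuring N) (S T : Subobject X) :
    onSub (erosion N) S ⊓ onSub (dilation N) T ≤ onSub (dilation N) (S ⊓ T) := by
  rw [le_iff_factors]
  intro Y z hz
  rw [Subobject.inf_factors, onSub_erosion_factors, onSub_dilation_factors h] at hz
  rw [onSub_dilation_factors h]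
  intro W A y hA
  have hS : Mem (const W S) (y ≫ z ≫ N) := by simpa [comp_const] using hz.1.precomp y
  have hI : Mem (interT A (const W S)) (y ≫ z ≫ N) := by
    simpa using (h.isFilter z).inter _ _ y hA hS
  refine (hz.2 _ y hI).mono ⟨fun t v ht => ?_⟩
  rw [← interT_const]
  simp only [mem_comp_interT] at ht ⊢
  exact ⟨ht.1.1, ht.1.2, ht.2⟩

theorem dilation_bot (h : IsStructuring N) : onSub (dilation N) ⊥ = ⊥ := by
  rw [eq_bot_iff, le_iff_factors]
  intro Y z hz
  rw [onSub_dilation_factors h] at hz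
  -- The whole of `X` is a neighborhood, so it would have to meet `⊥`.
  refine (hz (fullT Y X) (𝟙 Y) (by simpa using (h.isFilter z).full)).elim fun a y ha => ?_
  rw [mem_comp_interT, comp_const, mem_const] at ha
  exact bot_elim ha.2 _ _

/-- By adjunction the claim is `□¬S ∧ ◇S ≤ ⊥`, and the left side lies below `◇(¬S ∧ S) ≤ ◇⊥ = ⊥`. -/
theorem erosion_compl (h : IsStructuring N) (S : Subobject X) :
    onSub (erosion N) (S ⇨ ⊥) ≤ onSub (dilation N) S ⇨ ⊥ := by
  rw [le_himp_iff]
  refine (erosion_inf_dilation_le h _ _).trans ?_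
  exact (dilation_mono h himp_inf_le).trans (dilation_bot h).le

theorem erosion_le_erosion_erosion (h : IsTopological N) (S : Subobject X) :
    onSub (erosion N) S ≤ onSub (erosion N) (onSub (erosion N) S) := by
  rw [le_iff_factors]
  intro Y z hz
  rw [onSub_factors] at hz
  rw [onSub_factors, const_onSub, Category.assoc]
  exact mem_erosion_erosion h hz

theorem dilation_dilation_le (h : IsTopological N) (S : Subobject X) :
    onSub (dilation N) (onSub (dilation N) S) ≤ onSub (dilation N) S := by
  rw [le_iff_factors]
  intro Y z hz
  rw [onSub_factors, const_onSub, Category.assoc] at hz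
  rw [onSub_factors]
  exact mem_dilation_of_dilation_dilation h hz

end Modalities

theorem IsBoolean.himp_bot_himp_bot_le (h : IsBoolean C) {X : C} (S : Subobject X) :
    (S ⇨ ⊥) ⇨ ⊥ ≤ S := by
  rw [himp_bot, himp_bot]
  calc Sᶜᶜ = Sᶜᶜ ⊓ (S ⊔ Sᶜ) := by rw [h X S, inf_top_eq]
    _ = Sᶜᶜ ⊓ S ⊔ Sᶜᶜ ⊓ Sᶜ := inf_sup_left _ _ _
    _ ≤ S := sup_le inf_le_right (by rw [compl_inf_self]; exact bot_le)

end

end ElemTopos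

/-- The propositions `s4` and `classical` switch the optional axioms on, so their four combinations
of truth values give the four soundness statements. -/
theorem theorem1 {C : Type u} [Category.{v} C] [ElemTopos C] {PV : Type w}
    (s4 classical : Prop) (φ ψ : ElemTopos.Formula PV)
    (h : ElemTopos.Derivable s4 classical φ ψ) (M : ElemTopos.Model C PV)
    (hs4 : s4 → ElemTopos.IsTopological M.N) (hclassical : classical → ElemTopos.IsBoolean C) :
    M.Valid φ ψ := by
  change M.sem φ ≤ M.sem ψ
  have hN := M.isStructuring
  induction h with
  | identity | and_self_mp | and_self_mpr | neg_mp | neg_mpr => simp [ElemTopos.Model.sem]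
  | box_top_mp | tautology => exact le_top
  | box_top_mpr => exact (ElemTopos.erosion_top hN).ge
  | dia_bot_mp => exact (ElemTopos.dilation_bot hN).le
  | dia_bot_mpr | inconsistency => exact bot_le
  | duality φ => exact ElemTopos.erosion_compl hN _
  | box_and_mp φ ψ => exact (ElemTopos.erosion_inf hN _ _).le
  | box_and_mpr φ ψ => exact (ElemTopos.erosion_inf hN _ _).ge
  | dia_or φ ψ =>
    exact sup_le (ElemTopos.dilation_mono hN le_sup_left) (ElemTopos.dilation_mono hN le_sup_right)
  | axiomK φ ψ => exact ElemTopos.erosion_himp hN _ _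
  | box_T φ => exact ElemTopos.erosion_le hN _
  | dia_T φ => exact ElemTopos.le_dilation hN _
  | box_S4 h φ => exact ElemTopos.erosion_le_erosion_erosion (hs4 h) _
  | dia_S4 h φ => exact ElemTopos.dilation_dilation_le (hs4 h) _
  | dne h φ => exact (hclassical h).himp_bot_himp_bot_le _
  | cut _ _ ih₁ ih₂ => exact ih₁.trans ih₂
  | and_left => exact inf_le_left
  | and_right => exact inf_le_right
  | and_comm => exact (inf_comm _ _).le
  | and_intro _ _ ih₁ ih₂ => exact le_inf ih₁ ih₂
  | or_left => exact le_sup_left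
  | or_right => exact le_sup_right
  | or_comm => exact (sup_comm _ _).le
  | or_elim _ _ ih₁ ih₂ => exact sup_le ih₁ ih₂
  | or_elim_inv_left _ ih => exact le_sup_left.trans ih
  | or_elim_inv_right _ ih => exact le_sup_right.trans ih
  | distrib_mp => exact (inf_sup_left _ _ _).le
  | distrib_mpr => exact (inf_sup_left _ _ _).ge
  | imp_intro _ ih => exact le_himp_iff.2 ih
  | imp_elim _ ih => exact le_himp_iff.1 ih
  | box_mono _ ih => exact ElemTopos.erosion_mono hN ih
  | dia_mono _ ih => exact ElemTopos.dilation_mono hN ih
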